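/- Let $G$ be a finite simple connected graph and let $X\subseteq V(G)$. Two vertices $x,y$ of $G$ are called $X$-visible if there is a shortest $x,y$-path in $G$ none of whose internal vertices belongs to $X$. The set $X$ is a dual mutual-visibility set of $G$ if any two vertices of $X$ are $X$-visible and any two vertices of $V(G)\setminus X$ are $X$-visible. The dual visibility polynomial of $G$ is $\sum_{i\ge 0} r_i x^i$, where $r_i$ is the number of dual mutual-visibility sets of $G$ of cardinality $i$. Every polynomial with nonnegative integer coefficients and with constant term $1$ is the dual visibility polynomial of some finite simple connected graph. -/

import Mathlib

namespace SimpleGraph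

/-- `x` and `y` are `X`-visible: some shortest `x,y`-path has no internal vertex in `X`. -/
def IsVisible {V : Type*} (G : SimpleGraph V) (X : Set V) (x y : V) : Prop :=
  ∃ P : G.Walk x y, P.IsPath ∧ P.length = G.dist x y ∧
    ∀ v ∈ P.support, v ≠ x → v ≠ y → v ∉ X

/-- Dual mutual-visibility set: any two vertices of `X`, and any two vertices outside `X`,
are `X`-visible. -/
def IsDualMutualVisibilitySet {V : Type*} (G : SimpleGraph V) (X : Set V) : Prop :=
  (∀ x ∈ X, ∀ y ∈ X, G.IsVisible X x y) ∧ (∀ x ∉ X, ∀ y ∉ X, G.IsVisible X x y)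

/-- The number `r_i` of dual mutual-visibility sets of cardinality `i`. -/
noncomputable def dualVisibilityCount {V : Type*} [Fintype V] (G : SimpleGraph V) (i : ℕ) : ℕ :=
  {X : Finset V | G.IsDualMutualVisibilitySet (X : Set V) ∧ X.card = i}.ncard

/-- The dual visibility polynomial `∑ r_i x^i`; no vertex set has more than `|V|` elements. -/
noncomputable def dualVisibilityPolynomial {V : Type*} [Fintype V] (G : SimpleGraph V) :
    Polynomial ℕ :=
  ∑ i ∈ Finset.range (Fintype.card V + 1), Polynomial.monomial i (G.dualVisibilityCount i)

end SimpleGraph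

namespace SimpleGraph

variable {V : Type*} {G : SimpleGraph V} {X : Set V}

/-! The graph is built so that its dual mutual-visibility sets are exactly `∅` and prescribed
disjoint cliques, the fibres of `π`; taking `p.coeff (i + 1)` fibres of size `i + 1` for each `i`
then gives `p`.

The obstruction is local (`IsDualMutualVisibilitySet.mem_iff_notMem`): a unique common neighbour in
`X` separates its two ends. Petersen copies use it to keep `X` off the frame, and tips to force
whole fibres into `X`. A pair of separators, whose only common neighbours are two elements of
different fibres, prevents `X` from meeting both fibres. Conversely, a fibre is a clique that
shortest paths between outside vertices can bypass at no cost (`exists_walk_avoiding`), mostly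
through the hubs. -/

theorem isVisible_self (x : V) : G.IsVisible X x x :=
  ⟨Walk.nil, by simp, by simp, by simp⟩

theorem Adj.isVisible {x y : V} (h : G.Adj x y) : G.IsVisible X x y := by
  refine ⟨h.toWalk, by simp [h.ne], by simp [dist_eq_one_iff_adj.2 h], ?_⟩
  intro v hv h1 h2
  simp [Adj.toWalk] at hv
  tauto

/-- Two visible vertices at distance two have a common neighbour outside `X`. -/
theorem IsVisible.exists_common_adj {x y z : V} (h : G.IsVisible X x y) (hne : x ≠ y)
    (hnadj : ¬ G.Adj x y) (hxz : G.Adj x z) (hzy : G.Adj z y) :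
    ∃ w, G.Adj x w ∧ G.Adj w y ∧ w ∉ X := by
  obtain ⟨P, hP, hlen, hX⟩ := h
  have hle : P.length ≤ 2 := by
    rw [hlen]
    exact dist_le (Walk.cons hxz (Walk.cons hzy Walk.nil))
  match P, hle, hX with
  | Walk.nil, _, _ => exact absurd rfl hne
  | Walk.cons e Walk.nil, _, _ => exact absurd e hnadj
  | Walk.cons e (Walk.cons e' Walk.nil), _, hX =>
    exact ⟨_, e, e', hX _ (by simp) e.ne' e'.ne⟩
  | Walk.cons _ (Walk.cons _ (Walk.cons _ _)), hle, _ =>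
    simp at hle

/-- If `z` is the only common neighbour of the nonadjacent vertices `x` and `y` and belongs to
a dual mutual-visibility set, then exactly one of `x` and `y` belongs to it. -/
theorem IsDualMutualVisibilitySet.mem_iff_notMem {x y z : V}
    (h : G.IsDualMutualVisibilitySet X) (hne : x ≠ y) (hnadj : ¬ G.Adj x y) (hxz : G.Adj x z)
    (hzy : G.Adj z y) (huniq : ∀ w, G.Adj x w → G.Adj w y → w = z) (hz : z ∈ X) :
    x ∈ X ↔ y ∉ X := by
  have key : ¬ G.IsVisible X x y := fun hv ↦ by
    obtain ⟨w, h1, h2, h3⟩ := hv.exists_common_adj hne hnadj hxz hzy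
    exact h3 (huniq w h1 h2 ▸ hz)
  exact ⟨fun hx hy ↦ key (h.1 x hx y hy), fun hy ↦ by_contra fun hx ↦ key (h.2 x hx y hy)⟩

/-- A set of vertices whose outer neighbours are pairwise at distance at most two in the complement
does not obstruct shortest paths between vertices of the complement. -/
theorem exists_walk_avoiding
    (hX : ∀ u v, u ∉ X → v ∉ X → (∃ s ∈ X, G.Adj u s) → (∃ s ∈ X, G.Adj s v) →
      u ≠ v → ¬ G.Adj u v → ∃ w, w ∉ X ∧ G.Adj u w ∧ G.Adj w v)
    {z y : V} (P : G.Walk z y) (hy : y ∉ X) :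
    (z ∉ X → ∃ Q : G.Walk z y, Q.length ≤ P.length ∧ ∀ v ∈ Q.support, v ∉ X) ∧
    (z ∈ X → ∀ x ∉ X, (∃ s ∈ X, G.Adj x s) →
      ∃ Q : G.Walk x y, Q.length ≤ P.length + 1 ∧ ∀ v ∈ Q.support, v ∉ X) := by
  -- In the second clause `x` is where the walk entered `X`. Entering and leaving cost at least two
  -- edges, which pay for the detour of length at most two.
  induction P with
  | nil => exact ⟨fun h ↦ ⟨Walk.nil, le_rfl, by simpa using h⟩, fun h ↦ absurd h hy⟩
  | @cons z z' y e P ih =>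
    obtain ⟨ih1, ih2⟩ := ih hy
    constructor
    · intro hz
      by_cases hz' : z' ∈ X
      · obtain ⟨Q, hQ, hQX⟩ := ih2 hz' z hz ⟨z', hz', e⟩
        exact ⟨Q, by simpa using hQ, hQX⟩
      · obtain ⟨Q, hQ, hQX⟩ := ih1 hz'
        exact ⟨Walk.cons e Q, by simpa using hQ, by simpa using ⟨hz, hQX⟩⟩
    · intro hz x hx hxs
      by_cases hz' : z' ∈ X
      · obtain ⟨Q, hQ, hQX⟩ := ih2 hz' x hx hxs
        exact ⟨Q, by rw [Walk.length_cons]; omega, hQX⟩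
      · obtain ⟨Q, hQ, hQX⟩ := ih1 hz'
        rcases eq_or_ne x z' with rfl | hne
        · exact ⟨Q, by rw [Walk.length_cons]; omega, hQX⟩
        by_cases hadj : G.Adj x z'
        · exact ⟨Walk.cons hadj Q, by simp only [Walk.length_cons]; omega,
            by simpa using ⟨hx, hQX⟩⟩
        obtain ⟨w, hw, h1, h2⟩ := hX x z' hx hz' hxs ⟨z, hz, e⟩ hne hadj
        exact ⟨Walk.cons h1 (Walk.cons h2 Q), by simp only [Walk.length_cons]; omega,
          by simpa using ⟨hx, hw, hQX⟩⟩

/-- Rerouting a shortest path around `X` does not lengthen it, so the new walk is again a shortest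
path. -/
theorem IsClique.isDualMutualVisibilitySet (hG : G.Connected) (hclique : G.IsClique X)
    (hX : ∀ u v, u ∉ X → v ∉ X → (∃ s ∈ X, G.Adj u s) → (∃ s ∈ X, G.Adj s v) →
      u ≠ v → ¬ G.Adj u v → ∃ w, w ∉ X ∧ G.Adj u w ∧ G.Adj w v) :
    G.IsDualMutualVisibilitySet X := by
  constructor
  · intro x hx y hy
    rcases eq_or_ne x y with rfl | hne
    · exact isVisible_self x
    · exact (hclique hx hy hne).isVisible
  · intro x hx y hy
    obtain ⟨P, hP⟩ := hG.exists_walk_length_eq_dist x y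
    obtain ⟨Q, hQ, hQX⟩ := (exists_walk_avoiding hX P hy).1 hx
    have hlen : Q.length = G.dist x y := le_antisymm (hP ▸ hQ) (dist_le Q)
    exact ⟨Q, Q.isPath_of_length_eq_dist hlen, hlen, fun v hv _ _ ↦ hQX v hv⟩

theorem coeff_dualVisibilityPolynomial {V : Type*} [Fintype V] (G : SimpleGraph V) (i : ℕ) :
    G.dualVisibilityPolynomial.coeff i = G.dualVisibilityCount i := by
  simp only [dualVisibilityPolynomial, Polynomial.finsetSum_coeff, Polynomial.coeff_monomial,
    Finset.sum_ite_eq', Finset.mem_range]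
  split_ifs with h
  · rfl
  · symm
    rw [dualVisibilityCount, Set.ncard_eq_zero]
    refine Set.eq_empty_of_forall_notMem ?_
    rintro X ⟨-, hX⟩
    have := Finset.card_le_univ X
    omega

/-! ### The Petersen graph: cubic, without triangles or 4-cycles -/

/-- Adjacency in the Petersen graph: an outer pentagon, an inner pentagram and five spokes. -/
def petersenAdj (x y : Bool × Fin 5) : Bool :=
  match x, y with
  | (false, i), (false, j) => i = j + 1 || j = i + 1
  | (true, i), (true, j) => i = j + 2 || j = i + 2
  | (false, i), (true, j) => i = j
  | (true, i), (false, j) => i = j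

theorem petersenAdj_symm : ∀ x y, petersenAdj x y → petersenAdj y x := by decide

theorem petersenAdj_irrefl : ∀ x, ¬ petersenAdj x x := by decide

theorem petersenAdj_triangleFree : ∀ x y, petersenAdj x y → ∀ z, petersenAdj x z →
    ¬ petersenAdj y z := by decide

theorem petersenAdj_common_unique : ∀ x y, petersenAdj x y → ∀ z, petersenAdj x z → y ≠ z →
    ∀ w, petersenAdj y w → petersenAdj w z → w = x := by decide +kernel

theorem petersenAdj_exists_three : ∀ x, ∃ y₁, petersenAdj x y₁ ∧ ∃ y₂, petersenAdj x y₂ ∧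
    y₁ ≠ y₂ ∧ ∃ y₃, petersenAdj x y₃ ∧ y₁ ≠ y₃ ∧ y₂ ≠ y₃ := by decide

theorem exists_petersen_path : ∀ x, ∃ y, petersenAdj x y ∧
    (y = (false, 0) ∨ petersenAdj y (false, 0)) := by decide

/-! ### The graph with prescribed fibres -/

section FibreGraph

variable {T K : Type*} (π : T → K)

/-- The vertices of the frame carrying the fibres of `π`: two hubs, a private neighbour of each
element of `T`, and two separators for each pair of elements in different fibres. -/
inductive Frame : Type _
  | hub : Bool → Frame
  | tip : T → Frame
  | sep : (s t : T) → π s ≠ π t → Bool → Frame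

variable {π}

/-- Adjacency between vertices of the frame. -/
def Frame.Rel : Frame π → Frame π → Prop
  | .hub i, .hub j => i ≠ j
  | .hub _, .tip _ => True
  | .tip _, .hub _ => True
  | .hub i, .sep _ _ _ j => i = j
  | .sep _ _ _ i, .hub j => i = j
  | .tip _, .tip _ => False
  | .tip _, .sep _ _ _ _ => False
  | .sep _ _ _ _, .tip _ => False
  | .sep s t _ i, .sep s' t' _ j => (s, t) ≠ (s', t') ∧ i ≠ j

theorem Frame.Rel.ne {f g : Frame π} (h : f.Rel g) : f ≠ g := by
  rintro rfl
  cases f <;> simp [Frame.Rel] at h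

/-- Adjacency between vertices of the frame and elements of `T`. -/
def Frame.Att : Frame π → T → Prop
  | .hub _, _ => False
  | .tip s, t => s = t
  | .sep s s' _ _, t => t = s ∨ t = s'

variable (π) in
/-- The graph in which the fibres of `π` are cliques attached to the frame, and each vertex of the
frame is the root of a copy of the Petersen graph. -/
def fibreGraph : SimpleGraph ((Frame π × (Bool × Fin 5)) ⊕ T) where
  Adj
    | .inl (f, p), .inl (g, q) =>
      (f = g ∧ petersenAdj p q) ∨ (p = (false, 0) ∧ q = (false, 0) ∧ f.Rel g)
    | .inl (f, p), .inr t => p = (false, 0) ∧ f.Att t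
    | .inr t, .inl (f, p) => p = (false, 0) ∧ f.Att t
    | .inr s, .inr t => s ≠ t ∧ π s = π t
  symm := by
    constructor
    rintro (⟨f, p⟩ | s) (⟨g, q⟩ | t) h
    · rcases h with ⟨rfl, h⟩ | ⟨h1, h2, h3⟩
      · exact Or.inl ⟨rfl, petersenAdj_symm _ _ h⟩
      · refine Or.inr ⟨h2, h1, ?_⟩
        cases f <;> cases g <;> simp only [Frame.Rel] at h3 ⊢ <;> grind
    · exact h
    · exact h
    · exact ⟨h.1.symm, h.2.symm⟩
  loopless := by
    constructor
    rintro (⟨f, p⟩ | s) h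
    · rcases h with ⟨-, h⟩ | ⟨-, -, h⟩
      · exact petersenAdj_irrefl _ h
      · exact h.ne rfl
    · exact h.1 rfl

@[simp]
theorem fibreGraph_adj_inl_inl {f g : Frame π} {p q : Bool × Fin 5} :
    (fibreGraph π).Adj (.inl (f, p)) (.inl (g, q)) ↔
      (f = g ∧ petersenAdj p q) ∨ (p = (false, 0) ∧ q = (false, 0) ∧ f.Rel g) := Iff.rfl

@[simp]
theorem fibreGraph_adj_inl_inr {f : Frame π} {p : Bool × Fin 5} {t : T} :
    (fibreGraph π).Adj (.inl (f, p)) (.inr t) ↔ p = (false, 0) ∧ f.Att t := Iff.rfl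

@[simp]
theorem fibreGraph_adj_inr_inl {f : Frame π} {p : Bool × Fin 5} {t : T} :
    (fibreGraph π).Adj (.inr t) (.inl (f, p)) ↔ p = (false, 0) ∧ f.Att t := Iff.rfl

@[simp]
theorem fibreGraph_adj_inr_inr {s t : T} :
    (fibreGraph π).Adj (.inr s) (.inr t) ↔ s ≠ t ∧ π s = π t := Iff.rfl

theorem fibreGraph_connected : (fibreGraph π).Connected := by
  rw [connected_iff_exists_forall_reachable]
  refine ⟨.inl (.hub false, (false, 0)), ?_⟩
  have hhub (i : Bool) : (fibreGraph π).Reachable (.inl (.hub false, (false, 0)))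
      (.inl (.hub i, (false, 0))) := by
    cases i
    · rfl
    · exact Adj.reachable (by simp [Frame.Rel])
  have hframe (f : Frame π) : (fibreGraph π).Reachable (.inl (.hub false, (false, 0)))
      (.inl (f, (false, 0))) := by
    cases f with
    | hub i => exact hhub i
    | tip t => exact Adj.reachable (by simp [Frame.Rel])
    | sep s t h i => exact (hhub i).trans (Adj.reachable (by simp [Frame.Rel]))
  rintro (⟨f, p⟩ | t)
  · refine (hframe f).trans ?_
    obtain ⟨q, hq, hq'⟩ := exists_petersen_path p
    have h1 : (fibreGraph π).Reachable (.inl (f, q)) (.inl (f, p)) :=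
      Adj.reachable (by simp [petersenAdj_symm _ _ hq])
    rcases hq' with rfl | hq'
    · exact h1
    · exact (Adj.reachable (by simp [petersenAdj_symm _ _ hq'])).trans h1
  · exact (hframe (.tip t)).trans (Adj.reachable (by simp [Frame.Att]))

/-! ### Classification of the dual mutual-visibility sets -/

variable {X : Set ((Frame π × (Bool × Fin 5)) ⊕ T)}

/-- A copy meets the rest of the graph only at its root, so no vertex outside it has two neighbours
in it. -/
theorem eq_of_fibreGraph_adj_copy {f : Frame π} {p q q' : Bool × Fin 5}
    (hq : petersenAdj p q) (hq' : petersenAdj p q') (hne : q ≠ q') (w)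
    (h : (fibreGraph π).Adj (.inl (f, q)) w) (h' : (fibreGraph π).Adj w (.inl (f, q'))) :
    w = .inl (f, p) := by
  rcases w with ⟨g, r⟩ | t
  · simp only [fibreGraph_adj_inl_inl] at h h'
    have hu := petersenAdj_common_unique p q hq q' hq' hne r
    have hrel := @Frame.Rel.ne _ _ π
    grind
  · simp only [fibreGraph_adj_inl_inr, fibreGraph_adj_inr_inl] at h h'
    exact absurd (h.1.trans h'.1.symm) hne

theorem inl_notMem_of_isDualMutualVisibilitySet (hX : (fibreGraph π).IsDualMutualVisibilitySet X)
    (a : Frame π × (Bool × Fin 5)) : Sum.inl a ∉ X := by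
  obtain ⟨f, p⟩ := a
  intro hp
  have key {q q' : Bool × Fin 5} (hq : petersenAdj p q) (hq' : petersenAdj p q') (hne : q ≠ q') :
      Sum.inl (f, q) ∈ X ↔ Sum.inl (f, q') ∉ X := by
    refine hX.mem_iff_notMem (z := .inl (f, p)) (by simpa using hne) ?_ ?_ ?_
      (eq_of_fibreGraph_adj_copy hq hq' hne) hp
    · have h1 := petersenAdj_triangleFree p q hq q' hq'
      simp only [fibreGraph_adj_inl_inl]
      grind
    · simp [petersenAdj_symm _ _ hq]
    · simp [hq']
  obtain ⟨y₁, h₁, y₂, h₂, h₁₂, y₃, h₃, h₁₃, h₂₃⟩ := petersenAdj_exists_three p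
  -- Among three vertices, two agree on membership in `X`.
  have := key h₁ h₂ h₁₂
  have := key h₁ h₃ h₁₃
  have := key h₂ h₃ h₂₃
  tauto

theorem eq_fibre_of_isDualMutualVisibilitySet (hX : (fibreGraph π).IsDualMutualVisibilitySet X)
    {s : T} (hs : Sum.inr s ∈ X) : X = Sum.inr '' (π ⁻¹' {π s}) := by
  have hinl := inl_notMem_of_isDualMutualVisibilitySet hX
  ext (a | t)
  · simpa using hinl a
  simp only [Set.mem_image, Set.mem_preimage, Set.mem_singleton_iff, Sum.inr.injEq,
    exists_eq_right]
  constructor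
  · intro ht
    by_contra hne
    -- These separators have only `t` and `s` as common neighbours, and both lie in `X`.
    obtain ⟨w, h1, h2, h3⟩ := (hX.2 (.inl (.sep t s hne false, (false, 0))) (hinl _)
      (.inl (.sep t s hne true, (false, 0))) (hinl _)).exists_common_adj (z := .inr t)
      (by simp) (by simp [Frame.Rel, petersenAdj_irrefl]) (by simp [Frame.Att])
      (by simp [Frame.Att])
    rcases w with ⟨g, r⟩ | w
    · simp only [fibreGraph_adj_inl_inl] at h1 h2
      cases g <;> simp only [Frame.Rel] at h1 h2 <;> grind
    · simp only [fibreGraph_adj_inl_inr, Frame.Att] at h1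
      grind
  · intro ht
    rcases eq_or_ne t s with rfl | hne
    · exact hs
    -- The tip of `s` is outside `X` and is joined to `t` only through `s`.
    refine (hX.mem_iff_notMem (x := .inr t) (y := .inl (.tip s, (false, 0))) (by simp) ?_ ?_ ?_ ?_
      hs).2 (hinl _)
    · simpa [Frame.Att] using hne.symm
    · exact ⟨hne, ht⟩
    · simp [Frame.Att]
    · rintro (⟨g, r⟩ | w) h1 h2
      · simp only [fibreGraph_adj_inl_inl, fibreGraph_adj_inr_inl] at h1 h2
        cases g <;> simp only [Frame.Rel, Frame.Att] at h1 h2 <;> grind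
      · simp only [fibreGraph_adj_inr_inl, Frame.Att] at h2
        rw [h2.2]

theorem isDualMutualVisibilitySet_fibre (k : K) :
    (fibreGraph π).IsDualMutualVisibilitySet (Sum.inr '' (π ⁻¹' {k})) := by
  refine IsClique.isDualMutualVisibilitySet fibreGraph_connected ?_ ?_
  · rintro _ ⟨s, rfl, rfl⟩ _ ⟨t, ht, rfl⟩ hne
    exact ⟨by simpa using hne, by simpa using ht.symm⟩
  · rintro u v hu hv ⟨_, ⟨s, hs, rfl⟩, hus⟩ ⟨_, ⟨t, ht, rfl⟩, htv⟩ hne hnadj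
    simp only [Set.mem_preimage, Set.mem_singleton_iff] at hs ht
    rcases u with ⟨f, p⟩ | u
    swap
    · exact absurd ⟨u, hus.2.trans hs, rfl⟩ hu
    rcases v with ⟨g, q⟩ | v
    swap
    · exact absurd ⟨v, htv.2.symm.trans ht, rfl⟩ hv
    obtain ⟨rfl, hf⟩ := hus
    obtain ⟨rfl, hg⟩ := htv
    have hub (i : Bool) (h1 : f.Rel (.hub i)) (h2 : (Frame.hub i).Rel g) :
        ∃ w, w ∉ Sum.inr '' (π ⁻¹' {k}) ∧ (fibreGraph π).Adj (.inl (f, (false, 0))) w ∧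
          (fibreGraph π).Adj w (.inl (g, (false, 0))) :=
      ⟨.inl (.hub i, (false, 0)), by simp, by simp [h1], by simp [h2]⟩
    cases f with
    | hub i => exact hf.elim
    | tip a =>
      cases g with
      | hub j => exact hg.elim
      | tip b => exact hub false trivial trivial
      | sep b b' hb j => exact hub j trivial rfl
    | sep a a' ha i =>
      cases g with
      | hub j => exact hg.elim
      | tip b => exact hub i rfl trivial
      | sep b b' hb j =>
        rcases eq_or_ne i j with rfl | hij
        · exact hub i rfl rfl
        -- Opposite separators of different pairs are adjacent. For the same pair, `a` and `a'` lie
        -- in different fibres, so one of them avoids the fibre of `k`.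
        by_cases hab : (a, a') = (b, b')
        · simp only [Prod.mk.injEq] at hab
          obtain ⟨rfl, rfl⟩ := hab
          by_cases hak : π a = k
          · exact ⟨.inr a', by simpa [← hak] using ha.symm, by simp [Frame.Att],
              by simp [Frame.Att]⟩
          · exact ⟨.inr a, by simpa using hak, by simp [Frame.Att], by simp [Frame.Att]⟩
        · exact absurd (Or.inr ⟨rfl, rfl, hab, hij⟩) hnadj

instance Frame.instFinite [Finite T] : Finite (Frame π) := by
  let e : Frame π → Bool ⊕ T ⊕ (T × T × Bool)
    | .hub i => .inl i
    | .tip t => .inr (.inl t)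
    | .sep s t _ i => .inr (.inr (s, t, i))
  refine Finite.of_injective e ?_
  rintro (i | s | ⟨s, s', h, i⟩) (j | t | ⟨t, t', h', j⟩) h <;> simp_all [e]

theorem isDualMutualVisibilitySet_fibreGraph_iff :
    (fibreGraph π).IsDualMutualVisibilitySet X ↔ X = ∅ ∨ ∃ k, X = Sum.inr '' (π ⁻¹' {k}) := by
  constructor
  · intro hX
    rcases X.eq_empty_or_nonempty with h | ⟨a | s, hs⟩
    · exact Or.inl h
    · exact absurd hs (inl_notMem_of_isDualMutualVisibilitySet hX a)
    · exact Or.inr ⟨π s, eq_fibre_of_isDualMutualVisibilitySet hX hs⟩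
  · rintro (rfl | ⟨k, rfl⟩)
    · exact IsClique.isDualMutualVisibilitySet fibreGraph_connected (by simp) (by simp)
    · exact isDualMutualVisibilitySet_fibre k

/-! ### Counting the sets by cardinality -/

/-- Surjectivity matters: empty fibres would all give the same set. -/
theorem fibre_injective (hπ : Function.Surjective π) [Fintype T] [DecidableEq K] :
    Function.Injective fun k ↦ (Finset.univ.filter (π · = k)).map
      (Function.Embedding.inr : T ↪ (Frame π × (Bool × Fin 5)) ⊕ T) := by
  intro k l h
  obtain ⟨t, rfl⟩ := hπ k
  have ht := Finset.ext_iff.1 (Finset.map_injective _ h) t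
  simpa using ht

theorem dualVisibilityCount_fibreGraph_zero [Fintype T] [Fintype (Frame π)] :
    (fibreGraph π).dualVisibilityCount 0 = 1 := by
  rw [dualVisibilityCount, Set.ncard_eq_one]
  refine ⟨∅, ?_⟩
  ext X
  simp only [Set.mem_ofPred_eq, Finset.card_eq_zero, Set.mem_singleton_iff, and_iff_right_iff_imp]
  rintro rfl
  exact isDualMutualVisibilitySet_fibreGraph_iff.2 (Or.inl (by simp))

theorem dualVisibilityCount_fibreGraph_succ (hπ : Function.Surjective π) [Fintype T]
    [DecidableEq K] [Fintype (Frame π)] (i : ℕ) :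
    (fibreGraph π).dualVisibilityCount (i + 1) =
      {k | (Finset.univ.filter (π · = k)).card = i + 1}.ncard := by
  rw [dualVisibilityCount, ← Set.ncard_image_of_injective _ (fibre_injective hπ)]
  congr 1
  ext X
  simp only [Set.mem_ofPred_eq, Set.mem_image, isDualMutualVisibilitySet_fibreGraph_iff]
  have hcoe (k : K) : (X : Set ((Frame π × (Bool × Fin 5)) ⊕ T)) = Sum.inr '' (π ⁻¹' {k}) ↔
      (Finset.univ.filter (π · = k)).map Function.Embedding.inr = X := by
    rw [← Finset.coe_inj, eq_comm]
    simp [Set.preimage]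
  simp only [hcoe]
  constructor
  · rintro ⟨h | ⟨k, rfl⟩, hX⟩
    · simp [Finset.coe_eq_empty.1 h] at hX
    · exact ⟨k, by simpa using hX, rfl⟩
  · rintro ⟨k, hk, rfl⟩
    exact ⟨Or.inr ⟨k, rfl⟩, by simpa using hk⟩

end FibreGraph

end SimpleGraph

theorem ncard_sigma_fin_succ_eq_coeff (p : Polynomial ℕ) (i : ℕ) :
    {k : Σ i : Fin p.natDegree, Fin (p.coeff (i + 1)) | (k.1 : ℕ) + 1 = i + 1}.ncard =
      p.coeff (i + 1) := by
  by_cases hi : i < p.natDegree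
  · have : {k : Σ i : Fin p.natDegree, Fin (p.coeff (i + 1)) | (k.1 : ℕ) + 1 = i + 1} =
        Set.range (Sigma.mk (⟨i, hi⟩ : Fin p.natDegree)) := by
      ext ⟨⟨j, hj⟩, a⟩
      simp only [Set.mem_ofPred_eq, Set.mem_range, add_left_inj]
      constructor
      · rintro rfl
        exact ⟨a, rfl⟩
      · rintro ⟨b, hb⟩
        simpa using (congrArg (fun k ↦ (k.1 : ℕ)) hb).symm
    rw [this, ← Set.image_univ, Set.ncard_image_of_injective _ sigma_mk_injective,
      Set.ncard_univ, Nat.card_fin]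
  · rw [Polynomial.coeff_eq_zero_of_natDegree_lt (by omega), Set.ncard_eq_zero]
    refine Set.eq_empty_of_forall_notMem ?_
    rintro ⟨⟨j, hj⟩, a⟩ h
    simp only [Set.mem_ofPred_eq] at h
    omega

theorem mainTheorem2 (p : Polynomial ℕ) (hp : p.coeff 0 = 1) :
    ∃ (V : Type) (_ : Fintype V) (G : SimpleGraph V),
      G.Connected ∧ G.dualVisibilityPolynomial = p := by
  classical
  -- One index per required nonempty set. The shift by one leaves the constant term to `∅`.
  let K := Σ i : Fin p.natDegree, Fin (p.coeff (i + 1))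
  let π : (Σ k : K, Fin ((k.1 : ℕ) + 1)) → K := Sigma.fst
  have hπ : Function.Surjective π := fun k ↦ ⟨⟨k, 0⟩, rfl⟩
  have hcard (k : K) : (Finset.univ.filter (π · = k)).card = k.1 + 1 := by
    have h : Finset.univ.filter (π · = k) = Finset.univ.map (Function.Embedding.sigmaMk k) := by
      ext ⟨l, a⟩
      simp only [Finset.mem_filter, Finset.mem_univ, true_and, Finset.mem_map]
      constructor
      · rintro rfl
        exact ⟨a, rfl⟩
      · rintro ⟨b, hb⟩
        exact (congrArg Sigma.fst hb).symm
    rw [h, Finset.card_map, Finset.card_univ, Fintype.card_fin]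
  let _ : Fintype (SimpleGraph.Frame π) := Fintype.ofFinite _
  refine ⟨_, inferInstance, SimpleGraph.fibreGraph π, SimpleGraph.fibreGraph_connected, ?_⟩
  ext (_ | i)
  · rw [SimpleGraph.coeff_dualVisibilityPolynomial, hp,
      SimpleGraph.dualVisibilityCount_fibreGraph_zero]
  · rw [SimpleGraph.coeff_dualVisibilityPolynomial,
      SimpleGraph.dualVisibilityCount_fibreGraph_succ hπ]
    simp only [hcard]
    exact ncard_sigma_fin_succ_eq_coeff p i
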